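/- Let $\Sigma$ be a finite alphabet with at least two symbols, and let $ww=\{ww : w\in\Sigma^*\}$ be the copy language over $\Sigma$. 1. The language $ww$ is strictly context-sensitive: it is generated by a context-sensitive grammar, but it is not context-free. Here the rules of a context-sensitive grammar have the form $\alpha A\beta\to\alpha\gamma\beta$ with $A$ a nonterminal, $\alpha,\beta,\gamma$ strings of terminals and nonterminals and $\gamma\neq\varepsilon$; the rule $S\to\varepsilon$ for the initial symbol $S$ is also allowed, provided that $S$ does not occur on the right-hand side of any rule. 2. The language $ww$ is not definable in $\mathsf{C\text{-}RASP}$. Here a $\mathsf{C\text{-}RASP}$ program is a finite sequence of operations, each referring only to earlier ones. An operation is either Boolean-valued, of one of the forms $$P(i):=Q_a(i)\ (a\in\Sigma),\quad P(i):=\top,\quad P(i):=\neg P_1(i),\quad P(i):=P_1(i)\wedge P_2(i),\quad P(i):=C_1(i)\le C_2(i),$$ or integer-valued, of one of the forms $$C(i):=\#[j\le i]\,P(j),\quad C(i):=P(i)\,?\,C_1(i):C_2(i),\quad C(i):=C_1(i)\pm C_2(i),\quad C(i):=\min(C_1(i),C_2(i)),\quad C(i):=\max(C_1(i),C_2(i)),\quad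 C(i):=1.$$ Here $Q_a(i)$ says that the $i$-th symbol of the input is $a$, $\#[j\le i]\,P(j)$ is the number of $j\in\{1,\dots,i\}$ for which $P(j)$ holds, and $P(i)\,?\,C_1(i):C_2(i)$ equals $C_1(i)$ if $P(i)$ holds and $C_2(i)$ otherwise. The program accepts a string $x$ if its last Boolean-valued operation is true at position $i=|x|$ (for $x=\varepsilon$, at $i=0$, where every $Q_a$ is false), and it defines the set of strings that it accepts. 3. Recognizing $ww$ requires linear one-way communication across the midpoint: there is a constant $c>0$ such that for every $n$, in every deterministic protocol in which Alice holds the first half and Bob the second half of a string $x$ of length $2n$ over $\Sigma$, Alice sends one message to Bob, and Bob then decides correctly whether $x\in ww$, for every such $x$, Alice must send at least $c\cdot 2n$ bits for some $x$. -/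

import Mathlib

universe u

/-- The copy language `{ww : w ∈ α*}` over the alphabet `α`. -/
def copyLanguage (α : Type u) : Language α :=
  {x : List α | ∃ w : List α, x = w ++ w}

/-! ### Context-sensitive grammars -/

/-- A rewriting rule `left · core · right → left · output · right`: the nonterminal `core` is
replaced by the string `output` in the context `left _ right`. -/
structure ContextSensitiveRule (T : Type u) (N : Type) where
  left : List (Symbol T N)
  core : N
  right : List (Symbol T N)
  output : List (Symbol T N)

/-- The rule rewrites the string `x` into the string `y` by one application inside `x`. -/
def ContextSensitiveRule.Rewrites {T : Type u} {N : Type} (r : ContextSensitiveRule T N)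
    (x y : List (Symbol T N)) : Prop :=
  ∃ p q : List (Symbol T N),
    x = p ++ r.left ++ [Symbol.nonterminal r.core] ++ r.right ++ q ∧
    y = p ++ r.left ++ r.output ++ r.right ++ q

/-- A context-sensitive grammar over the terminals `T`, with the usual convention for the empty
word: every rule replaces its nonterminal by a nonempty string, except that the rule `S → ε` for
the initial symbol `S` is permitted if `S` does not occur on the right-hand side of any rule. -/
structure ContextSensitiveGrammar (T : Type u) where
  NT : Type
  initial : NT
  rules : Finset (ContextSensitiveRule T NT)
  nonempty_output : ∀ r ∈ rules, r.output ≠ [] ∨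
    (r.left = [] ∧ r.core = initial ∧ r.right = [] ∧
      ∀ r' ∈ rules, Symbol.nonterminal initial ∉ r'.left ++ r'.output ++ r'.right)

namespace ContextSensitiveGrammar

variable {T : Type u}

/-- One derivation step. -/
def Produces (g : ContextSensitiveGrammar T) (x y : List (Symbol T g.NT)) : Prop :=
  ∃ r ∈ g.rules, r.Rewrites x y

/-- Derivability in finitely many steps. -/
def Derives (g : ContextSensitiveGrammar T) :
    List (Symbol T g.NT) → List (Symbol T g.NT) → Prop :=
  Relation.ReflTransGen g.Produces

/-- The set of terminal words derivable from the initial symbol. -/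
def language (g : ContextSensitiveGrammar T) : Language T :=
  {w : List T | g.Derives [Symbol.nonterminal g.initial] (w.map Symbol.terminal)}

end ContextSensitiveGrammar

/-- A language is context-sensitive if it is generated by a context-sensitive grammar. -/
def IsContextSensitive {T : Type u} (L : Language T) : Prop :=
  ∃ g : ContextSensitiveGrammar T, g.language = L

/-! ### C-RASP -/

namespace CRASP

/-- Boolean-valued operations that may refer to `b` earlier Boolean-valued operations `P_p` and to
`c` earlier count-valued operations `C_s`. -/
inductive BoolOp (α : Type u) (b c : ℕ) : Type u
  /-- `P(i) := Q_a(i)`, "the symbol at position `i` is `a`" -/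
  | symbol (a : α)
  /-- `P(i) := ⊤` -/
  | top
  /-- `P(i) := ¬ P_p(i)` -/
  | not (p : Fin b)
  /-- `P(i) := P_p(i) ∧ P_q(i)` -/
  | and (p q : Fin b)
  /-- `P(i) := C_s(i) ≤ C_t(i)` -/
  | le (s t : Fin c)

/-- Count-valued (that is, integer-valued) operations that may refer to `b` earlier Boolean-valued
operations `P_p` and to `c` earlier count-valued operations `C_s`. -/
inductive CountOp (b c : ℕ) : Type
  /-- `C(i) := #[j ≤ i] P_p(j)` -/
  | count (p : Fin b)
  /-- `C(i) := P_p(i) ? C_s(i) : C_t(i)` -/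
  | cond (p : Fin b) (s t : Fin c)
  /-- `C(i) := C_s(i) + C_t(i)` -/
  | add (s t : Fin c)
  /-- `C(i) := C_s(i) - C_t(i)` -/
  | sub (s t : Fin c)
  /-- `C(i) := min (C_s(i), C_t(i))` -/
  | min (s t : Fin c)
  /-- `C(i) := max (C_s(i), C_t(i))` -/
  | max (s t : Fin c)
  /-- `C(i) := 1` -/
  | one

/-- A C-RASP program over the alphabet `α`: a finite sequence of operations, each of which refers
only to operations that precede it. `Program α b c` is the type of the programs with `b`
Boolean-valued and `c` count-valued operations. -/
inductive Program (α : Type u) : ℕ → ℕ → Type u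
  | nil : Program α 0 0
  | bool {b c : ℕ} (P : Program α b c) (op : BoolOp α b c) : Program α (b + 1) c
  | count {b c : ℕ} (P : Program α b c) (op : CountOp b c) : Program α b (c + 1)

/-- The values of `b` Boolean-valued and `c` count-valued operations at each position. -/
structure Values (b c : ℕ) where
  bool : Fin b → ℕ → Prop
  count : Fin c → ℕ → ℤ

variable {α : Type u} {b c : ℕ}

/-- The value of a Boolean-valued operation at position `i` of `w`, given the values `V` of the
earlier operations. The positions of `w` are `1, …, |w|`. -/
def BoolOp.eval (w : List α) (V : Values b c) : BoolOp α b c → ℕ → Prop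
  | .symbol a, i => 1 ≤ i ∧ w[i - 1]? = some a
  | .top, _ => True
  | .not p, i => ¬ V.bool p i
  | .and p q, i => V.bool p i ∧ V.bool q i
  | .le s t, i => V.count s i ≤ V.count t i

open Classical in
/-- The value of a count-valued operation at position `i`, given the values `V` of the earlier
operations. -/
noncomputable def CountOp.eval (V : Values b c) : CountOp b c → ℕ → ℤ
  | .count p, i => (((Finset.Icc 1 i).filter fun j => V.bool p j).card : ℤ)
  | .cond p s t, i => if V.bool p i then V.count s i else V.count t i
  | .add s t, i => V.count s i + V.count t i
  | .sub s t, i => V.count s i - V.count t i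
  | .min s t, i => Min.min (V.count s i) (V.count t i)
  | .max s t, i => Max.max (V.count s i) (V.count t i)
  | .one, _ => 1

/-- The values of all the operations of a program on the input `w`. -/
noncomputable def Program.eval (w : List α) : {b c : ℕ} → Program α b c → Values b c
  | _, _, .nil => ⟨fun p => p.elim0, fun s => s.elim0⟩
  | _, _, .bool P op =>
    ⟨Fin.snoc (α := fun _ => ℕ → Prop) (P.eval w).bool (op.eval w (P.eval w)), (P.eval w).count⟩
  | _, _, .count P op =>
    ⟨(P.eval w).bool, Fin.snoc (α := fun _ => ℕ → ℤ) (P.eval w).count (op.eval (P.eval w))⟩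

/-- A program accepts `w` if its last Boolean-valued operation is true at the last position `|w|`.
(For the empty word this is the position `0`, where no symbol is read and all counts
`#[j ≤ i] P(j)` vanish.) -/
def Program.Accepts (P : Program α (b + 1) c) (w : List α) : Prop :=
  (P.eval w).bool (Fin.last b) w.length

/-- A language is definable in C-RASP if some C-RASP program accepts exactly its words. -/
def Definable (L : Language α) : Prop :=
  ∃ (b c : ℕ) (P : Program α (b + 1) c), ∀ w : List α, P.Accepts w ↔ w ∈ L

end CRASP

/-! ### One-way communication -/

/-- A one-way protocol: Alice, who holds a word `u`, sends the bits `message u` to Bob; Bob, who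
holds a word `v`, then accepts or rejects. -/
structure OneWayProtocol (α : Type u) where
  message : List α → List Bool
  accept : List Bool → List α → Prop

namespace OneWayProtocol

variable {α : Type u}

/-- The protocol recognizes `L` on all the words `uv` where Alice holds the prefix `u` of length `m`
and Bob the remaining `k` symbols `v`. -/
def Recognizes (P : OneWayProtocol α) (L : Language α) (m k : ℕ) : Prop :=
  ∀ u v : List α, u.length = m → v.length = k → (P.accept (P.message u) v ↔ u ++ v ∈ L)

/-- Alice never sends more than `B` bits on words of length `m`. -/
def CostAtMost (P : OneWayProtocol α) (m B : ℕ) : Prop :=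
  ∀ u : List α, u.length = m → (P.message u).length ≤ B

end OneWayProtocol

/-! For words of equal length, `u ++ v` is a copy exactly when `u = v`. All three negative results
are pigeonhole arguments on words coding the `2 ^ n` Boolean vectors.

Communication: two first halves with the same message cannot be told apart by Bob, so there are at
least `2 ^ n` messages. C-RASP: an operation sees the past only through prefix counts, so a first
half of length `n` leaves behind one of at most `(n + 1) ^ b` count vectors, `b` being the number of
Boolean operations (`Program.accepts_append_congr`). This is eventually below `2 ^ n`.

Context-freeness is refuted by interchange. Copies built from `2 ^ k` periodic words each contain a
factor longer than `k` and at most half the word, derived from one nonterminal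
(`Yields.exists_infix`). Two of them share rule, offset and factor length, so their factors may be
exchanged; but a factor of a copy is forced by the rest (`eq_of_append_mem_copyLanguage`), and more
than `k` symbols of a `k`-periodic word determine it.

The grammar generates pairs `fst a, snd a`, sorts them by context-sensitive swaps, and turns `fst`
into terminals from the left end and `snd` from the right end only. Soundness is the invariant
`Balanced`: the first-copy letters and the second-copy letters always spell the same word, even
during a swap. -/

theorem append_mem_copyLanguage_iff {α : Type u} {u v : List α} (h : u.length = v.length) :
    u ++ v ∈ copyLanguage α ↔ u = v := by
  constructor
  · rintro ⟨w, hw⟩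
    have hl := congrArg List.length hw
    simp only [List.length_append] at hl
    obtain ⟨rfl, rfl⟩ := List.append_inj hw (by omega)
    rfl
  · rintro rfl
    exact ⟨u, rfl⟩

/-- Words of length `n` encoding the Boolean vectors of length `n`. -/
def binaryWord {α : Type u} (e : Bool → α) {n : ℕ} (f : Fin n → Bool) : List α :=
  List.ofFn fun i => e (f i)

@[simp] theorem length_binaryWord {α : Type u} (e : Bool → α) {n : ℕ} (f : Fin n → Bool) :
    (binaryWord e f).length = n := by
  simp [binaryWord]

theorem binaryWord_injective {α : Type u} {e : Bool → α} (he : Function.Injective e) (n : ℕ) :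
    Function.Injective (binaryWord e : (Fin n → Bool) → List α) := by
  intro f g h
  have h' := List.ofFn_injective h
  funext i
  exact he (congrFun h' i)

theorem exists_injective_bool (α : Type u) [Nontrivial α] :
    ∃ e : Bool → α, Function.Injective e := by
  obtain ⟨a, b, hab⟩ := exists_pair_ne α
  refine ⟨fun t => if t then a else b, ?_⟩
  intro s t
  cases s <;> cases t <;> simp [hab, hab.symm]

/-- Supplies the pigeonhole inequality for both the C-RASP and the context-free argument. -/
theorem exists_mul_pow_lt_two_pow (a b c : ℕ) :
    ∃ n, 0 < n ∧ c * (a * n + 1) ^ b < 2 ^ n := by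
  have h : Filter.Tendsto (fun n : ℕ => (c * (a + 1) ^ b : ℝ) * ((n : ℝ) ^ b / 2 ^ n))
      Filter.atTop (nhds ((c * (a + 1) ^ b : ℝ) * 0)) :=
    (tendsto_pow_const_div_const_pow_of_one_lt b (by norm_num : (1 : ℝ) < 2)).const_mul _
  rw [mul_zero] at h
  obtain ⟨n, hn, hn1⟩ := ((h.eventually (gt_mem_nhds one_pos)).and
    (Filter.eventually_ge_atTop 1)).exists
  refine ⟨n, hn1, ?_⟩
  have h2 : (0 : ℝ) < 2 ^ n := by positivity
  have hlt : (c * (a + 1) ^ b : ℝ) * (n : ℝ) ^ b < 2 ^ n := by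
    rwa [← mul_div_assoc, div_lt_one h2] at hn
  -- Since `1 ≤ n`, the summand `1` is absorbed: `a * n + 1 ≤ (a + 1) * n`.
  have hle : c * (a * n + 1) ^ b ≤ c * (a + 1) ^ b * n ^ b := by
    rw [mul_assoc, ← mul_pow]
    gcongr
    nlinarith
  refine hle.trans_lt ?_
  exact_mod_cast hlt

/-! ### One-way communication -/

theorem card_lists_bool_le (B : ℕ) :
    ∃ s : Finset (List Bool), (∀ l : List Bool, l.length ≤ B → l ∈ s) ∧ s.card < 2 ^ (B + 1) := by
  induction B with
  | zero => exact ⟨{[]}, by simp, by simp⟩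
  | succ B ih =>
    obtain ⟨s, hs, hc⟩ := ih
    classical
    refine ⟨insert [] (s.image (List.cons true) ∪ s.image (List.cons false)), ?_, ?_⟩
    · rintro (_ | ⟨b, l⟩) hl
      · simp
      · have := hs l (by simpa using hl)
        cases b <;> simp [this]
    · have h1 := Finset.card_insert_le ([] : List Bool)
        (s.image (List.cons true) ∪ s.image (List.cons false))
      have h2 := Finset.card_union_le (s.image (List.cons true)) (s.image (List.cons false))
      have h3 := Finset.card_image_le (s := s) (f := List.cons true)
      have h4 := Finset.card_image_le (s := s) (f := List.cons false)
      rw [pow_succ]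
      omega

/-- If `B < n`, there are fewer than `2 ^ (B + 1) ≤ 2 ^ n` messages, so two binary words collide.
Bob, holding one of them, must then accept the other as well. -/
theorem OneWayProtocol.le_cost_of_recognizes_copyLanguage {α : Type u} [Nontrivial α] {n B : ℕ}
    {P : OneWayProtocol α} (hP : P.Recognizes (copyLanguage α) n n) (hB : P.CostAtMost n B) :
    n ≤ B := by
  obtain ⟨e, he⟩ := exists_injective_bool α
  by_contra! hlt
  obtain ⟨s, hs, hc⟩ := card_lists_bool_le B
  have hcard : s.card < (Finset.univ : Finset (Fin n → Bool)).card := by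
    have : 2 ^ (B + 1) ≤ 2 ^ n := Nat.pow_le_pow_right (by norm_num) hlt
    simp only [Finset.card_univ, Fintype.card_fun, Fintype.card_bool, Fintype.card_fin]
    omega
  obtain ⟨f, -, g, -, hfg, heq⟩ := Finset.exists_ne_map_eq_of_card_lt_of_maps_to hcard
    (f := fun f => P.message (binaryWord e f)) (fun f _ => hs _ (hB _ (by simp)))
  have h1 := hP (binaryWord e f) (binaryWord e f) (by simp) (by simp)
  have h2 := hP (binaryWord e g) (binaryWord e f) (by simp) (by simp)
  rw [append_mem_copyLanguage_iff (by simp)] at h1 h2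
  rw [heq] at h1
  exact hfg (binaryWord_injective he n (h2.1 (h1.2 rfl))).symm

/-! ### C-RASP -/

namespace CRASP

variable {α : Type u}

/-- Causality: counts range over `j ≤ i` and every other operation is local, so nothing to the right
of position `i` matters. -/
theorem Program.eval_congr_of_take {w w' : List α} {n : ℕ} (h : ∀ i < n, w[i]? = w'[i]?)
    {b c : ℕ} (P : Program α b c) :
    (∀ p, ∀ i ≤ n, ((P.eval w).bool p i ↔ (P.eval w').bool p i)) ∧
    (∀ s, ∀ i ≤ n, (P.eval w).count s i = (P.eval w').count s i) := by
  classical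
  induction P with
  | nil => exact ⟨fun p => p.elim0, fun s => s.elim0⟩
  | bool P op ih =>
    refine ⟨fun p i hi => ?_, ih.2⟩
    induction p using Fin.lastCases with
    | cast p => simpa [Program.eval] using ih.1 p i hi
    | last =>
      cases op <;> simp only [Program.eval, Fin.snoc_last, BoolOp.eval]
      case symbol a => exact and_congr_right fun h1 => by rw [h _ (by omega)]
      case not p => rw [ih.1 p i hi]
      case and p q => rw [ih.1 p i hi, ih.1 q i hi]
      case le s t => rw [ih.2 s i hi, ih.2 t i hi]
  | count P op ih =>
    refine ⟨ih.1, fun p i hi => ?_⟩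
    induction p using Fin.lastCases with
    | cast p => simpa [Program.eval] using ih.2 p i hi
    | last =>
      cases op <;> simp only [Program.eval, Fin.snoc_last, CountOp.eval]
      case count p =>
        rw [Finset.filter_congr fun j hj => ih.1 p j ((Finset.mem_Icc.1 hj).2.trans hi)]
      case cond p s t => rw [ih.2 s i hi, ih.2 t i hi, if_congr (ih.1 p i hi) rfl rfl]
      all_goals simp only [ih.2 _ i hi]

open Classical in
/-- The number of positions up to `n` at which the Boolean-valued operation `p` holds. -/
noncomputable def Program.prefixCount {b c : ℕ} (P : Program α b c) (w : List α) (n : ℕ)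
    (p : Fin b) : ℕ :=
  ((Finset.Icc 1 n).filter fun j => (P.eval w).bool p j).card

theorem card_filter_Icc_eq_add (p : ℕ → Prop) [DecidablePred p] {n i : ℕ} (h : n ≤ i) :
    ((Finset.Icc 1 i).filter p).card =
      ((Finset.Icc 1 n).filter p).card + ((Finset.Ioc n i).filter p).card := by
  rw [← Finset.card_union_of_disjoint, ← Finset.filter_union]
  · congr 2
    ext j
    simp only [Finset.mem_union, Finset.mem_Icc, Finset.mem_Ioc]
    omega
  · refine Finset.disjoint_filter_filter (Finset.disjoint_left.2 fun j h1 h2 => ?_)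
    simp only [Finset.mem_Icc, Finset.mem_Ioc] at h1 h2
    omega

/-- Beyond position `n`, the values of a program depend only on the symbols after position `n` and
on the counts at position `n`. -/
theorem Program.eval_congr_of_drop {w w' : List α} {n : ℕ} (h : ∀ i, n ≤ i → w[i]? = w'[i]?)
    {b c : ℕ} (P : Program α b c) (hc : ∀ p, P.prefixCount w n p = P.prefixCount w' n p) :
    (∀ p, ∀ i, n < i → ((P.eval w).bool p i ↔ (P.eval w').bool p i)) ∧
    (∀ s, ∀ i, n < i → (P.eval w).count s i = (P.eval w').count s i) := by
  classical
  induction P with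
  | nil => exact ⟨fun p => p.elim0, fun s => s.elim0⟩
  | bool P op ih =>
    replace ih := ih fun p => by
      simpa only [Program.prefixCount, Program.eval, Fin.snoc_castSucc] using hc p.castSucc
    refine ⟨fun p i hi => ?_, ih.2⟩
    induction p using Fin.lastCases with
    | cast p => simpa [Program.eval] using ih.1 p i hi
    | last =>
      cases op <;> simp only [Program.eval, Fin.snoc_last, BoolOp.eval]
      case symbol a => exact and_congr_right fun h1 => by rw [h _ (by omega)]
      case not p => rw [ih.1 p i hi]
      case and p q => rw [ih.1 p i hi, ih.1 q i hi]
      case le s t => rw [ih.2 s i hi, ih.2 t i hi]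
  | count P op ih =>
    replace ih := ih hc
    refine ⟨ih.1, fun p i hi => ?_⟩
    induction p using Fin.lastCases with
    | cast p => simpa [Program.eval] using ih.2 p i hi
    | last =>
      cases op <;> simp only [Program.eval, Fin.snoc_last, CountOp.eval]
      case count p =>
        -- The count splits at `n`: the part up to `n` agrees by `hc`, the part beyond `n` by
        -- induction.
        rw [card_filter_Icc_eq_add _ hi.le, card_filter_Icc_eq_add _ hi.le]
        rw [Finset.filter_congr fun j hj => ih.1 p j (Finset.mem_Ioc.1 hj).1]
        exact congrArg (fun m : ℕ => ((m + _ : ℕ) : ℤ)) (hc p)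
      case cond p s t => rw [ih.2 s i hi, ih.2 t i hi, if_congr (ih.1 p i hi) rfl rfl]
      all_goals simp only [ih.2 _ i hi]

/-- By causality the counts at the end of the prefix do not depend on `v`, and from there on they
are all that remains of the prefix. Nonemptiness of `v` puts the final position strictly beyond the
prefix. -/
theorem Program.accepts_append_congr {b c : ℕ} (P : Program α (b + 1) c) {u u' v : List α}
    (hlen : u.length = u'.length) (hv : v ≠ [])
    (hc : ∀ p, P.prefixCount u u.length p = P.prefixCount u' u.length p) :
    P.Accepts (u ++ v) ↔ P.Accepts (u' ++ v) := by
  have key : ∀ x : List α, ∀ p, P.prefixCount (x ++ v) x.length p = P.prefixCount x x.length p := by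
    intro x p
    unfold Program.prefixCount
    classical
    rw [Finset.filter_congr fun j hj => (P.eval_congr_of_take (w := x ++ v) (w' := x)
      (n := x.length) (fun i hi => List.getElem?_append_left hi)).1 p j (Finset.mem_Icc.1 hj).2]
  have := (P.eval_congr_of_drop (w := u ++ v) (w' := u' ++ v) (n := u.length) (fun i hi => by
    rw [List.getElem?_append_right hi, List.getElem?_append_right (hlen ▸ hi), hlen])
    (fun p => by rw [key, hc, hlen, key])).1 (Fin.last b) (u ++ v).length (by
      have := List.length_pos_iff.2 hv
      simp only [List.length_append]
      omega)
  unfold Program.Accepts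
  rw [this]
  simp [hlen]

theorem not_definable_copyLanguage [Nontrivial α] : ¬ Definable (copyLanguage α) := by
  rintro ⟨b, c, P, hP⟩
  obtain ⟨e, he⟩ := exists_injective_bool α
  obtain ⟨n, hn0, hn⟩ := exists_mul_pow_lt_two_pow 1 (b + 1) 1
  have hle : ∀ w p, P.prefixCount w n p < n + 1 := by
    classical
    intro w p
    refine Nat.lt_succ_of_le ((Finset.card_filter_le _ _).trans ?_)
    simp
  let φ : (Fin n → Bool) → (Fin (b + 1) → Fin (n + 1)) :=
    fun f p => ⟨P.prefixCount (binaryWord e f) n p, hle _ _⟩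
  -- There are `(n + 1) ^ (b + 1)` possible count vectors for `2 ^ n` words.
  obtain ⟨f, g, hfg, heq⟩ := Fintype.exists_ne_map_eq_of_card_lt φ (by simpa using hn)
  have h := P.accepts_append_congr (u := binaryWord e f) (u' := binaryWord e g)
    (v := binaryWord e f) (by simp) (by rw [← List.length_pos_iff]; simpa using hn0)
    (fun p => by simpa [φ] using congrArg Fin.val (congrFun heq p))
  rw [hP, hP, append_mem_copyLanguage_iff (by simp), append_mem_copyLanguage_iff (by simp)] at h
  exact hfg (binaryWord_injective he n (h.1 rfl)).symm

end CRASP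

/-! ### The copy language is not context-free -/

namespace ContextFreeGrammar

variable {T : Type u} {g : ContextFreeGrammar T}

/-- `g.Yields s w`: a forest of derivation trees with roots `s` and leaves `w`. -/
inductive Yields (g : ContextFreeGrammar T) : List (Symbol T g.NT) → List T → Prop
  | nil : Yields g [] []
  | terminal (a : T) {s : List (Symbol T g.NT)} {w : List T} (h : Yields g s w) :
      Yields g (Symbol.terminal a :: s) (a :: w)
  | nonterminal {r : ContextFreeRule T g.NT} (hr : r ∈ g.rules) {s : List (Symbol T g.NT)}
      {v w : List T} (hv : Yields g r.output v) (hw : Yields g s w) :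
      Yields g (Symbol.nonterminal r.input :: s) (v ++ w)

theorem Yields.derives {s : List (Symbol T g.NT)} {w : List T} (h : g.Yields s w) :
    g.Derives s (w.map Symbol.terminal) := by
  induction h with
  | nil => exact Derives.refl _
  | terminal a _ ih => exact ih.append_left [Symbol.terminal a]
  | @nonterminal r hr s v w _ _ ih₁ ih₂ =>
    rw [List.map_append]
    have h1 : g.Produces (Symbol.nonterminal r.input :: s) (r.output ++ s) :=
      ⟨r, hr, ContextFreeRule.Rewrites.head s⟩
    exact h1.single.trans ((ih₁.append_right s).trans (ih₂.append_left _))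

theorem Yields.append {s t : List (Symbol T g.NT)} {v w : List T} (hs : g.Yields s v)
    (ht : g.Yields t w) : g.Yields (s ++ t) (v ++ w) := by
  induction hs with
  | nil => exact ht
  | terminal a _ ih => exact ih.terminal a
  | nonterminal hr hv _ _ ih =>
    rw [List.append_assoc]
    exact Yields.nonterminal hr hv ih

theorem Yields.exists_split {s t : List (Symbol T g.NT)} {w : List T} (h : g.Yields (s ++ t) w) :
    ∃ w₁ w₂, w = w₁ ++ w₂ ∧ g.Yields s w₁ ∧ g.Yields t w₂ := by
  induction s generalizing w with
  | nil => exact ⟨[], w, rfl, Yields.nil, h⟩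
  | cons x s ih =>
    cases h with
    | terminal a h =>
      obtain ⟨w₁, w₂, rfl, h₁, h₂⟩ := ih h
      exact ⟨a :: w₁, w₂, rfl, h₁.terminal a, h₂⟩
    | nonterminal hr hv h =>
      obtain ⟨w₁, w₂, rfl, h₁, h₂⟩ := ih h
      exact ⟨_ ++ w₁, w₂, (List.append_assoc _ _ _).symm, Yields.nonterminal hr hv h₁, h₂⟩

theorem yields_map_terminal (w : List T) : g.Yields (w.map Symbol.terminal) w := by
  induction w with
  | nil => exact Yields.nil
  | cons a w ih => exact ih.terminal a

/-- Induction from the first step: the forest for the rewritten string is split around the rule's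
output, which is then regrouped under one root. -/
theorem Derives.yields {s : List (Symbol T g.NT)} {w : List T}
    (h : g.Derives s (w.map Symbol.terminal)) : g.Yields s w := by
  induction h using Relation.ReflTransGen.head_induction_on with
  | refl => exact yields_map_terminal w
  | head h _ ih =>
    obtain ⟨r, hr, hrw⟩ := h
    obtain ⟨p, q, rfl, rfl⟩ := hrw.exists_parts
    obtain ⟨w₁, w₂, rfl, h₁, h₂⟩ := ih.exists_split
    obtain ⟨w₃, w₄, rfl, h₃, h₄⟩ := h₁.exists_split
    rw [List.append_assoc, List.append_assoc]
    exact h₃.append (Yields.nonterminal hr h₄ h₂)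

/-- A long enough word contains an infix of length between `m / K` and `m` that is generated by a
single nonterminal, where `K` bounds the lengths of the right-hand sides. -/
theorem Yields.exists_infix {K m : ℕ} (hK : ∀ r ∈ g.rules, r.output.length ≤ K) (hm : K ≤ m)
    {s : List (Symbol T g.NT)} {w : List T} (h : g.Yields s w) (hw : s.length * m < K * w.length) :
    ∃ r ∈ g.rules, ∃ x y z, w = x ++ y ++ z ∧ m < K * y.length ∧ y.length ≤ m ∧
      g.Derives [Symbol.nonterminal r.input] (y.map Symbol.terminal) ∧
      g.Derives s (x.map Symbol.terminal ++ [Symbol.nonterminal r.input] ++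
        z.map Symbol.terminal) := by
  induction h with
  | nil => simp at hw
  | terminal a _ ih =>
    -- Removing a terminal root lowers the left side of `hw` by `m` and the right side by only `K ≤
    -- m`.
    obtain ⟨r, hr, x, y, z, rfl, h1, h2, h3, h4⟩ := ih (by
      simp only [List.length_cons] at hw
      nlinarith)
    exact ⟨r, hr, a :: x, y, z, rfl, h1, h2, h3, h4.append_left [Symbol.terminal a]⟩
  | @nonterminal r hr s v w hv hw' ih₁ ih₂ =>
    have hd : g.Derives [Symbol.nonterminal r.input] r.output :=
      Produces.single ⟨r, hr, ContextFreeRule.Rewrites.input_output⟩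
    -- Three cases for the first tree: its yield `v` is short and the remaining forest still
    -- satisfies the bound; `v` has the desired length and the root is chosen; or `v` is too long
    -- and the search descends to the at most `K` children.
    rcases le_or_gt (K * v.length) m with h | h
    · obtain ⟨r', hr', x, y, z, rfl, h1, h2, h3, h4⟩ := ih₂ (by
        simp only [List.length_cons, List.length_append] at hw
        nlinarith)
      refine ⟨r', hr', v ++ x, y, z, by simp, h1, h2, h3, ?_⟩
      have h5 := (hd.trans hv.derives).append_right s
      have h6 := h4.append_left (v.map Symbol.terminal)
      simpa using h5.trans h6
    rcases le_or_gt v.length m with h' | h'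
    · refine ⟨r, hr, [], v, w, rfl, h, h', hd.trans hv.derives, ?_⟩
      exact hw'.derives.append_left [Symbol.nonterminal r.input]
    · obtain ⟨r', hr', x, y, z, rfl, h1, h2, h3, h4⟩ := ih₁ (by
        have h7 := hK r hr
        have h8 : 0 < K := by
          rcases Nat.eq_zero_or_pos K with rfl | h
          · simp at h
          · exact h
        calc r.output.length * m ≤ K * m := Nat.mul_le_mul_right _ h7
          _ < K * v.length := Nat.mul_lt_mul_of_pos_left h' h8)
      refine ⟨r', hr', x, y, z ++ w, by simp, h1, h2, h3, ?_⟩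
      have h5 := (hd.trans h4).append_right s
      have h6 := hw'.derives.append_left (x.map Symbol.terminal ++
        [Symbol.nonterminal r'.input] ++ z.map Symbol.terminal)
      simpa using h5.trans h6

end ContextFreeGrammar

/-! ### Rigidity of copies and the interchange argument -/

theorem getElem?_add_of_mem_copyLanguage {α : Type u} {w : List α} (hw : w ∈ copyLanguage α)
    {N : ℕ} (hN : w.length = 2 * N) {p : ℕ} (hp : p < N) : w[p + N]? = w[p]? := by
  obtain ⟨v, rfl⟩ := hw
  have hv : v.length = N := by
    rw [List.length_append] at hN
    omega
  rw [List.getElem?_append_right (by omega), List.getElem?_append_left (by omega)]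
  congr 1
  omega

/-- In a copy, a factor of at most half the length is determined by the remaining symbols. -/
theorem eq_of_append_mem_copyLanguage {α : Type u} {x y y' z : List α} {N : ℕ}
    (h : x ++ y ++ z ∈ copyLanguage α) (h' : x ++ y' ++ z ∈ copyLanguage α)
    (hlen : y.length = y'.length) (hy : y.length ≤ N) (hN : (x ++ y ++ z).length = 2 * N) :
    y = y' := by
  have hN' : (x ++ y' ++ z).length = 2 * N := by
    rw [← hN]
    simp [hlen]
  have hmid : ∀ t : List α, ∀ i < t.length, (x ++ t ++ z)[x.length + i]? = t[i]? := by
    intro t i hi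
    rw [List.append_assoc, List.getElem?_append_right (by omega),
      List.getElem?_append_left (by omega)]
    congr 1
    omega
  have hout : ∀ q, q < x.length ∨ x.length + y.length ≤ q →
      (x ++ y ++ z)[q]? = (x ++ y' ++ z)[q]? := by
    rintro q (hq | hq)
    · rw [List.append_assoc, List.append_assoc, List.getElem?_append_left hq,
        List.getElem?_append_left hq]
    · rw [List.getElem?_append_right (by simpa using hq),
        List.getElem?_append_right (by simpa [← hlen] using hq)]
      simp [hlen]
  refine List.ext_getElem? fun i => ?_
  rcases lt_or_ge i y.length with hi | hi
  · rw [← hmid y i hi, ← hmid y' i (hlen ▸ hi)]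
    -- The equal symbol at distance `N`, to the right or to the left, lies outside the factor
    -- because the factor has length at most `N`.
    rcases lt_or_ge (x.length + i) N with hlt | hge
    · rw [← getElem?_add_of_mem_copyLanguage h hN hlt,
        ← getElem?_add_of_mem_copyLanguage h' hN' hlt]
      exact hout _ (by omega)
    · obtain ⟨p, hp⟩ := Nat.exists_eq_add_of_le hge
      have hl := hN
      simp only [List.length_append] at hl
      rw [hp, add_comm N p, getElem?_add_of_mem_copyLanguage h hN (by omega),
        getElem?_add_of_mem_copyLanguage h' hN' (by omega)]
      exact hout _ (by omega)
  · rw [List.getElem?_eq_none hi, List.getElem?_eq_none (hlen ▸ hi)]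

/-- The word of length `n` with period `k` whose first symbols encode `f`. -/
def periodicWord {α : Type u} (e : Bool → α) {k : ℕ} (hk : 0 < k) (f : Fin k → Bool) (n : ℕ) :
    List α :=
  (List.range n).map fun p => e (f ⟨p % k, Nat.mod_lt _ hk⟩)

theorem periodicWord_mem_copyLanguage {α : Type u} (e : Bool → α) {k : ℕ} (hk : 0 < k)
    (f : Fin k → Bool) (m : ℕ) : periodicWord e hk f (2 * (m * k)) ∈ copyLanguage α := by
  refine ⟨periodicWord e hk f (m * k), ?_⟩
  rw [periodicWord, two_mul, List.range_add, List.map_append]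
  congr 1
  simp [Function.comp_def, periodicWord]

theorem not_isContextFree_copyLanguage (α : Type u) [Nontrivial α] :
    ¬ (copyLanguage α).IsContextFree := by
  rintro ⟨g, hg⟩
  obtain ⟨e, he⟩ := exists_injective_bool α
  set K := g.rules.sup (fun r => r.output.length) + 1 with hKdef
  have hK : ∀ r ∈ g.rules, r.output.length ≤ K := fun r hr =>
    (Finset.le_sup (f := fun r : ContextFreeRule α g.NT => r.output.length) hr).trans
      (Nat.le_succ _)
  -- The pigeonholes are triples of a rule, an offset and a factor length, the last two at most the
  -- word length `2 * K * k`.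
  obtain ⟨k, hk, hlt⟩ := exists_mul_pow_lt_two_pow (2 * K) 2 g.rules.card
  have hKpos : 0 < K := Nat.succ_pos _
  have hword : ∀ f : Fin k → Bool, ∃ r ∈ g.rules, ∃ x y z,
      periodicWord e hk f (2 * (K * k)) = x ++ y ++ z ∧ k < y.length ∧ y.length ≤ K * k ∧
      g.Derives [Symbol.nonterminal r.input] (y.map Symbol.terminal) ∧
      g.Derives [Symbol.nonterminal g.initial] (x.map Symbol.terminal ++
        [Symbol.nonterminal r.input] ++ z.map Symbol.terminal) := by
    intro f
    have hmem := periodicWord_mem_copyLanguage e hk f K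
    rw [← hg] at hmem
    obtain ⟨r, hr, x, y, z, h1, h2, h3, h4, h5⟩ :=
      (ContextFreeGrammar.Derives.yields hmem).exists_infix hK (m := K * k)
        (Nat.le_mul_of_pos_right _ hk) (by
          simp only [List.length_singleton, periodicWord, List.length_map, List.length_range]
          have : 0 < K * k := Nat.mul_pos hKpos hk
          nlinarith)
    exact ⟨r, hr, x, y, z, h1, lt_of_mul_lt_mul_left h2 (Nat.zero_le K), h3, h4, h5⟩
  choose r hr x y z hxyz hky hyK hder hctx using hword
  have hlenw : ∀ f, (x f ++ y f ++ z f).length = 2 * (K * k) := fun f => by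
    rw [← hxyz]
    simp [periodicWord]
  let S := g.rules ×ˢ (Finset.range (2 * K * k + 1) ×ˢ Finset.range (2 * K * k + 1))
  obtain ⟨f, -, f', -, hne, heq⟩ := Finset.exists_ne_map_eq_of_card_lt_of_maps_to
    (s := (Finset.univ : Finset (Fin k → Bool))) (t := S)
    (f := fun f => (r f, (x f).length, (y f).length))
    (by simpa [S, sq] using hlt)
    (fun f _ => by
      have := hlenw f
      simp only [List.length_append] at this
      simp only [S, Finset.coe_product, Set.mem_prod, Finset.mem_coe, Finset.mem_range]
      refine ⟨hr f, ?_, ?_⟩ <;> nlinarith)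
  simp only [Prod.mk.injEq] at heq
  obtain ⟨hrr, hxx, hyy⟩ := heq
  -- Both factors derive from the same nonterminal, so that of `f'` fits into the context of `f`.
  have hswap : x f ++ y f' ++ z f ∈ copyLanguage α := by
    rw [← hg, ContextFreeGrammar.mem_language_iff]
    have h1 := (((hrr ▸ hder f').append_left ((x f).map Symbol.terminal)).append_right
      ((z f).map Symbol.terminal) : g.Derives (_ ++ [Symbol.nonterminal (r f).input] ++ _) _)
    simpa using (hctx f).trans (by simpa using h1)
  have hy := eq_of_append_mem_copyLanguage
    (hxyz f ▸ periodicWord_mem_copyLanguage e hk f K) hswap hyy (hyK f) (hlenw f)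
  have hsym : ∀ f i, i < (y f).length →
      (y f)[i]? = some (e (f ⟨((x f).length + i) % k, Nat.mod_lt _ hk⟩)) := by
    intro f i hi
    have hl := hlenw f
    have h1 : (x f ++ y f ++ z f)[(x f).length + i]? = (y f)[i]? := by
      rw [List.append_assoc, List.getElem?_append_right (by omega),
        List.getElem?_append_left (by omega)]
      congr 1
      omega
    simp only [List.length_append] at hl
    rw [← h1, ← hxyz, periodicWord, List.getElem?_map, List.getElem?_range (by omega)]
    rfl
  apply hne
  funext j
  -- This index inside the factor falls on residue `j` modulo `k`; adding `k * (x f).length` keeps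
  -- the subtraction from truncating.
  have hi : (j + k * (x f).length - (x f).length) % k < k := Nat.mod_lt _ hk
  have hmod : ((x f).length + (j + k * (x f).length - (x f).length) % k) % k = j := by
    have : (x f).length ≤ k * (x f).length := Nat.le_mul_of_pos_left _ hk
    rw [Nat.add_mod_mod, show (x f).length + (j + k * (x f).length - (x f).length) =
      j + k * (x f).length by omega, Nat.add_mul_mod_self_left, Nat.mod_eq_of_lt j.2]
  have h1 := hsym f _ (hi.trans (hky f))
  have h2 := hsym f' _ (hi.trans (hky f'))
  rw [← hy, ← hxx, h1] at h2
  have h3 := he (Option.some.inj h2)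
  simpa only [hmod] using h3

/-! ### A context-sensitive grammar for the copy language -/

namespace ContextSensitiveGrammar

variable {T : Type u} {g : ContextSensitiveGrammar T}

theorem Produces.append {x y : List (Symbol T g.NT)} (h : g.Produces x y)
    (p q : List (Symbol T g.NT)) : g.Produces (p ++ x ++ q) (p ++ y ++ q) := by
  obtain ⟨r, hr, p', q', rfl, rfl⟩ := h
  exact ⟨r, hr, p ++ p', q' ++ q, by simp, by simp⟩

theorem Derives.append {x y : List (Symbol T g.NT)} (h : g.Derives x y)
    (p q : List (Symbol T g.NT)) : g.Derives (p ++ x ++ q) (p ++ y ++ q) := by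
  induction h with
  | refl => exact Relation.ReflTransGen.refl
  | tail _ h ih => exact ih.tail (h.append p q)

theorem derives_of_mem {r : ContextSensitiveRule T g.NT} (hr : r ∈ g.rules) :
    g.Derives (r.left ++ [Symbol.nonterminal r.core] ++ r.right)
      (r.left ++ r.output ++ r.right) :=
  Relation.ReflTransGen.single ⟨r, hr, [], [], by simp, by simp⟩

end ContextSensitiveGrammar

/-- The nonterminals of the grammar for the copy language: `fst a` and `snd a` stand for a letter
`a` of the first and of the second copy; `held a b` and `swapped a b` occur while `snd a, fst b`
is being rewritten into `fst b, snd a`. -/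
inductive CopyNT (ι : Type) : Type
  | start
  | gen
  | fst (a : ι)
  | snd (a : ι)
  | held (a b : ι)
  | swapped (a b : ι)

namespace CopyNT

variable {ι : Type} {T : Type u}

open Symbol in
/-- The rules of the grammar for the copy language, over the alphabet `e '' ι`. -/
inductive IsRule (e : ι → T) : ContextSensitiveRule T (CopyNT ι) → Prop
  | start_nil : IsRule e ⟨[], start, [], []⟩
  | start_pair (a : ι) : IsRule e ⟨[], start, [], [terminal (e a), terminal (e a)]⟩
  | start_gen (a : ι) :
      IsRule e ⟨[], start, [], [nonterminal gen, nonterminal (fst a), terminal (e a)]⟩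
  | gen_pair (a : ι) :
      IsRule e ⟨[], gen, [], [nonterminal gen, nonterminal (fst a), nonterminal (snd a)]⟩
  | gen_last (a : ι) : IsRule e ⟨[], gen, [], [terminal (e a), nonterminal (snd a)]⟩
  | hold (a b : ι) : IsRule e ⟨[], snd a, [nonterminal (fst b)], [nonterminal (held a b)]⟩
  | swap (a b : ι) :
      IsRule e ⟨[nonterminal (held a b)], fst b, [], [nonterminal (swapped a b)]⟩
  | release (a b : ι) :
      IsRule e ⟨[], held a b, [nonterminal (swapped a b)], [nonterminal (fst b)]⟩
  | finish (a b : ι) :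
      IsRule e ⟨[nonterminal (fst b)], swapped a b, [], [nonterminal (snd a)]⟩
  | fst_terminal (c b : ι) : IsRule e ⟨[terminal (e c)], fst b, [], [terminal (e b)]⟩
  | snd_terminal (c b : ι) : IsRule e ⟨[], snd b, [terminal (e c)], [terminal (e b)]⟩

open Symbol in
theorem finite_isRule [Finite ι] (e : ι → T) : {r | IsRule e r}.Finite := by
  let f : Fin 11 → ι → ι → ContextSensitiveRule T (CopyNT ι) := fun i a b =>
    ![⟨[], start, [], []⟩,
      ⟨[], start, [], [terminal (e a), terminal (e a)]⟩,
      ⟨[], start, [], [nonterminal gen, nonterminal (fst a), terminal (e a)]⟩,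
      ⟨[], gen, [], [nonterminal gen, nonterminal (fst a), nonterminal (snd a)]⟩,
      ⟨[], gen, [], [terminal (e a), nonterminal (snd a)]⟩,
      ⟨[], snd a, [nonterminal (fst b)], [nonterminal (held a b)]⟩,
      ⟨[nonterminal (held a b)], fst b, [], [nonterminal (swapped a b)]⟩,
      ⟨[], held a b, [nonterminal (swapped a b)], [nonterminal (fst b)]⟩,
      ⟨[nonterminal (fst b)], swapped a b, [], [nonterminal (snd a)]⟩,
      ⟨[terminal (e a)], fst b, [], [terminal (e b)]⟩,
      ⟨[], snd b, [terminal (e a)], [terminal (e b)]⟩] i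
  -- The rule for the empty word is added separately, since the range of `f` is empty when `ι` is.
  refine Set.Finite.subset ((Set.finite_range fun p : Fin 11 × ι × ι => f p.1 p.2.1 p.2.2).union
    (Set.finite_singleton ⟨[], start, [], []⟩)) ?_
  rintro r (_ | a | a | a | a | ⟨a, b⟩ | ⟨a, b⟩ | ⟨a, b⟩ | ⟨a, b⟩ | ⟨a, b⟩ | ⟨a, b⟩)
  · exact Or.inr rfl
  · exact Or.inl ⟨(1, a, a), rfl⟩
  · exact Or.inl ⟨(2, a, a), rfl⟩
  · exact Or.inl ⟨(3, a, a), rfl⟩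
  · exact Or.inl ⟨(4, a, a), rfl⟩
  · exact Or.inl ⟨(5, a, b), rfl⟩
  · exact Or.inl ⟨(6, a, b), rfl⟩
  · exact Or.inl ⟨(7, a, b), rfl⟩
  · exact Or.inl ⟨(8, a, b), rfl⟩
  · exact Or.inl ⟨(9, a, b), rfl⟩
  · exact Or.inl ⟨(10, a, b), rfl⟩

/-- The grammar for the copy language over the alphabet `e '' ι`. -/
noncomputable def grammar [Finite ι] (e : ι → T) : ContextSensitiveGrammar T where
  NT := CopyNT ι
  initial := start
  rules := (finite_isRule e).toFinset
  nonempty_output := by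
    intro r hr
    have hs : ∀ r' ∈ (finite_isRule e).toFinset,
        Symbol.nonterminal start ∉ r'.left ++ r'.output ++ r'.right := by
      intro r' hr'
      rw [Set.Finite.mem_toFinset] at hr'
      cases hr' <;> simp
    rw [Set.Finite.mem_toFinset] at hr
    cases hr
    case start_nil => exact Or.inr ⟨rfl, rfl, rfl, hs⟩
    all_goals exact Or.inl (List.cons_ne_nil _ _)

/-! ### Completeness: every copy is derivable -/

section Derivations

variable [Finite ι] (e : ι → T)

/-- Derivability in the grammar for the copy language. -/
def Derives (x y : List (Symbol T (CopyNT ι))) : Prop :=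
  (grammar e).Derives x y

variable {e}

theorem Derives.refl (x : List (Symbol T (CopyNT ι))) : Derives e x x :=
  Relation.ReflTransGen.refl

theorem Derives.trans {x y z : List (Symbol T (CopyNT ι))} (h₁ : Derives e x y)
    (h₂ : Derives e y z) : Derives e x z :=
  Relation.ReflTransGen.trans h₁ h₂

theorem Derives.append {x y : List (Symbol T (CopyNT ι))} (h : Derives e x y)
    (p q : List (Symbol T (CopyNT ι))) : Derives e (p ++ x ++ q) (p ++ y ++ q) :=
  ContextSensitiveGrammar.Derives.append (g := grammar e) h p q

theorem Derives.append_left {x y : List (Symbol T (CopyNT ι))} (h : Derives e x y)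
    (p : List (Symbol T (CopyNT ι))) : Derives e (p ++ x) (p ++ y) := by
  simpa using h.append p []

theorem Derives.append_right {x y : List (Symbol T (CopyNT ι))} (h : Derives e x y)
    (q : List (Symbol T (CopyNT ι))) : Derives e (x ++ q) (y ++ q) := by
  simpa using h.append [] q

theorem IsRule.derives {r : ContextSensitiveRule T (CopyNT ι)} (h : IsRule e r) :
    Derives e (r.left ++ [Symbol.nonterminal r.core] ++ r.right)
      (r.left ++ r.output ++ r.right) :=
  ContextSensitiveGrammar.derives_of_mem (g := grammar e) ((finite_isRule e).mem_toFinset.2 h)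

variable (e)

/-- The string of terminals for `l`. -/
abbrev terminals (l : List ι) : List (Symbol T (CopyNT ι)) :=
  l.map fun a => Symbol.terminal (e a)

/-- The letters of `l` in the first copy. -/
abbrev fsts (T : Type u) (l : List ι) : List (Symbol T (CopyNT ι)) :=
  l.map fun a => Symbol.nonterminal (fst a)

/-- The letters of `l` in the second copy. -/
abbrev snds (T : Type u) (l : List ι) : List (Symbol T (CopyNT ι)) :=
  l.map fun a => Symbol.nonterminal (snd a)

theorem derives_swap (a b : ι) :
    Derives e (snds T [a] ++ fsts T [b]) (fsts T [b] ++ snds T [a]) :=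
  (IsRule.hold (e := e) a b).derives.trans <| (IsRule.swap a b).derives.trans <|
    (IsRule.release a b).derives.trans (IsRule.finish a b).derives

theorem derives_snd_fsts (a : ι) (l : List ι) :
    Derives e (snds T [a] ++ fsts T l) (fsts T l ++ snds T [a]) := by
  induction l with
  | nil => exact Derives.refl _
  | cons b l ih =>
    exact ((derives_swap e a b).append_right (fsts T l)).trans (ih.append_left (fsts T [b]))

theorem derives_snds_fsts (l m : List ι) :
    Derives e (snds T l ++ fsts T m) (fsts T m ++ snds T l) := by
  induction l with
  | nil => simpa using Derives.refl (e := e) (fsts T m)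
  | cons a l ih =>
    have h := (derives_snd_fsts e a m).append_right (snds T l)
    have h' := ih.append_left (snds T [a])
    simp only [List.append_assoc] at h h'
    exact h'.trans h

/-- Each new pair appears directly after `gen`, so the word grows at its front; the new `snd` is
then moved past the older `fst` letters. -/
theorem derives_gen (l : List ι) :
    Derives e [Symbol.nonterminal gen]
      (Symbol.nonterminal gen :: (fsts T l ++ snds T l)) := by
  induction l with
  | nil => exact Derives.refl _
  | cons b l ih =>
    refine ih.trans (((IsRule.gen_pair b).derives.append_right (fsts T l ++ snds T l)).trans ?_)
    have h := (derives_snd_fsts e b l).append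
      (Symbol.nonterminal gen :: fsts T [b]) (snds T l)
    simpa using h

theorem derives_fsts (c : ι) (l : List ι) :
    Derives e (terminals e [c] ++ fsts T l) (terminals e [c] ++ terminals e l) := by
  induction l generalizing c with
  | nil => exact Derives.refl _
  | cons b l ih =>
    exact ((IsRule.fst_terminal c b).derives.append_right (fsts T l)).trans
      ((ih b).append_left (terminals e [c]))

theorem derives_snds (l : List ι) (c : ι) :
    Derives e (snds T l ++ terminals e [c]) (terminals e l ++ terminals e [c]) := by
  induction l with
  | nil => exact Derives.refl _
  | cons b l ih =>
    refine (ih.append_left (snds T [b])).trans ?_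
    cases l with
    | nil => exact (IsRule.snd_terminal c b).derives
    | cons d l =>
      exact (IsRule.snd_terminal d b).derives.append_right (terminals e l ++ terminals e [c])

/-- Words of length at least two are written `a`, `m`, `z`: `start_gen` places the last letter `z`
with its right-end terminal, `gen` produces `m`, and `gen_last` places `a` with its left-end
terminal. After sorting, terminals spread inwards from both ends. -/
theorem derives_copy (l : List ι) :
    Derives e [Symbol.nonterminal start] (terminals e (l ++ l)) := by
  rcases l with _ | ⟨a, l⟩
  · exact IsRule.start_nil.derives
  rcases List.eq_nil_or_concat l with rfl | ⟨m, z, rfl⟩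
  · exact (IsRule.start_pair a).derives
  have h₁ : Derives e [Symbol.nonterminal start]
      ([Symbol.nonterminal gen] ++ fsts T [z] ++ terminals e [z]) :=
    (IsRule.start_gen z).derives
  have h₂ := (derives_gen e m).append_right (fsts T [z] ++ terminals e [z])
  have h₃ : Derives e
      ([Symbol.nonterminal gen] ++ (fsts T m ++ snds T m ++ fsts T [z] ++ terminals e [z]))
      (terminals e [a] ++ snds T [a] ++
        (fsts T m ++ snds T m ++ fsts T [z] ++ terminals e [z])) :=
    (IsRule.gen_last a).derives.append_right _
  have h₄ := (derives_snds_fsts e m [z]).append (terminals e [a] ++ snds T [a] ++ fsts T m)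
    (terminals e [z])
  have h₅ := (derives_snd_fsts e a (m ++ [z])).append (terminals e [a])
    (snds T m ++ terminals e [z])
  have h₆ := (derives_fsts e a (m ++ [z])).append_right (snds T (a :: m) ++ terminals e [z])
  have h₇ := (derives_snds e (a :: m) z).append_left (terminals e (a :: (m ++ [z])))
  simp only [List.map_cons, List.map_nil, List.map_append, List.append_assoc, List.cons_append,
    List.nil_append, List.concat_eq_append] at h₁ h₂ h₃ h₄ h₅ h₆ h₇ ⊢
  exact h₁.trans <| h₂.trans <| h₃.trans <| h₄.trans <| h₅.trans <| h₆.trans h₇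

end Derivations

/-! ### Soundness: every derived word is a copy -/

section Invariant

open Classical in
/-- The letter of the first copy for which the nonterminal stands if its left neighbour is the
nonterminal `prev`. -/
noncomputable def fstLetter (prev : Option (CopyNT ι)) : CopyNT ι → List ι
  | fst a => [a]
  | swapped a b => if prev = some (held a b) then [b] else []
  | _ => []

open Classical in
/-- The letter of the second copy for which the nonterminal stands if its left neighbour is the
nonterminal `prev`. -/
noncomputable def sndLetter (prev : Option (CopyNT ι)) : CopyNT ι → List ι
  | snd a => [a]
  | held a _ => [a]
  | swapped a b => if prev = some (held a b) then [] else [a]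
  | _ => []

/-- The concatenation of the words `f prev x` for the members `x` of a list with left neighbours
`prev`. -/
def track (f : Option (CopyNT ι) → CopyNT ι → List ι) :
    Option (CopyNT ι) → List (CopyNT ι) → List ι
  | _, [] => []
  | prev, x :: l => f prev x ++ track f (some x) l

theorem track_append (f : Option (CopyNT ι) → CopyNT ι → List ι) (prev : Option (CopyNT ι))
    (l m : List (CopyNT ι)) :
    track f prev (l ++ m) = track f prev l ++ track f (l.getLast?.or prev) m := by
  induction l generalizing prev with
  | nil => simp [track]
  | cons x l ih =>
    simp only [List.cons_append, track, ih, List.append_assoc]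
    congr 3
    cases l <;> simp [List.getLast?_cons]

/-- The nonterminal is not of the form `held a b`. -/
def NotHeld (prev : Option (CopyNT ι)) : Prop :=
  ∀ a b, prev ≠ some (held a b)

/-- The left neighbour matters only when it is some `held a b`, so any other neighbour may be
replaced. -/
theorem track_fstLetter_congr {p q : Option (CopyNT ι)} (hp : NotHeld p) (hq : NotHeld q)
    (l : List (CopyNT ι)) : track fstLetter p l = track fstLetter q l := by
  cases l with
  | nil => rfl
  | cons x l => cases x <;> simp [track, fstLetter, hp _ _, hq _ _]

theorem track_sndLetter_congr {p q : Option (CopyNT ι)} (hp : NotHeld p) (hq : NotHeld q)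
    (l : List (CopyNT ι)) : track sndLetter p l = track sndLetter q l := by
  cases l with
  | nil => rfl
  | cons x l => cases x <;> simp [track, sndLetter, hp _ _, hq _ _]

/-- The sentential form with the terminals `u`, the nonterminals `m` and the terminals `v`. -/
def form (e : ι → T) (u : List ι) (m : List (CopyNT ι)) (v : List ι) :
    List (Symbol T (CopyNT ι)) :=
  terminals e u ++ m.map Symbol.nonterminal ++ terminals e v

/-- The first copy and the second copy agree in a sentential form. -/
structure Balanced (u : List ι) (m : List (CopyNT ι)) (v : List ι) : Prop where
  start_notMem : start ∉ m
  gen_notMem : gen ∉ m ∨ u = [] ∧ ∃ l, m = gen :: l ∧ gen ∉ l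
  eq : u ++ track fstLetter none m = track sndLetter none m ++ v

/-- Locates the rewritten nonterminal inside the middle block, so that the context required by a
rule can be read off from its neighbours. -/
theorem exists_eq_of_append_nonterminal_eq_form {e : ι → T} {p q : List (Symbol T (CopyNT ι))}
    {c : CopyNT ι} {u v : List ι} {m : List (CopyNT ι)}
    (h : p ++ Symbol.nonterminal c :: q = form e u m v) :
    ∃ m₁ m₂, m = m₁ ++ c :: m₂ ∧ p = terminals e u ++ m₁.map Symbol.nonterminal ∧
      q = m₂.map Symbol.nonterminal ++ terminals e v := by
  rw [form, List.append_assoc] at h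
  have hnot : ∀ (l : List ι) (s t : List (Symbol T (CopyNT ι))),
      terminals e l ≠ s ++ Symbol.nonterminal c :: t := by
    intro l s t hl
    have : Symbol.nonterminal c ∈ terminals e l := by simp [hl]
    simp at this
  have h1 : ∃ p', p = terminals e u ++ p' ∧
      p' ++ Symbol.nonterminal c :: q = m.map Symbol.nonterminal ++ terminals e v := by
    rcases List.append_eq_append_iff.1 h with ⟨a, ha, hb⟩ | ⟨a, ha, hb⟩
    · rcases a with _ | ⟨x, a⟩
      · exact ⟨[], by simpa using ha.symm, by simpa using hb⟩
      · obtain ⟨rfl, -⟩ := List.cons.inj hb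
        exact (hnot _ _ _ ha).elim
    · exact ⟨a, ha, hb.symm⟩
  obtain ⟨p', rfl, h2⟩ := h1
  rcases List.append_eq_append_iff.1 h2 with ⟨a, ha, hb⟩ | ⟨a, ha, hb⟩
  · rcases a with _ | ⟨x, a⟩
    · exact (hnot v [] q (by simpa using hb.symm)).elim
    · obtain ⟨rfl, rfl⟩ := List.cons.inj hb
      obtain ⟨m₁, m₂, rfl, rfl, h3⟩ := List.map_eq_append_iff.1 ha
      obtain ⟨y, m₂, rfl, hy, rfl⟩ := List.map_eq_cons_iff.1 h3
      obtain rfl := Symbol.nonterminal.inj hy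
      exact ⟨m₁, m₂, rfl, rfl, rfl⟩
  · exact (hnot v a q hb).elim

theorem exists_eq_of_nonterminal_cons_eq {e : ι → T} {q : List (Symbol T (CopyNT ι))}
    {c : CopyNT ι} {v : List ι} {m : List (CopyNT ι)}
    (h : Symbol.nonterminal c :: q = m.map Symbol.nonterminal ++ terminals e v) :
    ∃ m', m = c :: m' := by
  cases m with
  | nil => cases v <;> simp at h
  | cons x m =>
    simp only [List.map_cons, List.cons_append, List.cons.injEq, Symbol.nonterminal.injEq] at h
    exact ⟨m, by rw [h.1]⟩

/-- Forces a rule with a terminal right context to act at the right end of the nonterminal block. -/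
theorem eq_nil_of_terminal_cons_eq {e : ι → T} {q : List (Symbol T (CopyNT ι))}
    {c : T} {v : List ι} {m : List (CopyNT ι)}
    (h : Symbol.terminal c :: q = m.map Symbol.nonterminal ++ terminals e v) : m = [] := by
  cases m with
  | nil => rfl
  | cons x m => simp at h

theorem exists_eq_of_append_nonterminal_eq {e : ι → T} {p : List (Symbol T (CopyNT ι))}
    {c : CopyNT ι} {u : List ι} {m : List (CopyNT ι)}
    (h : p ++ [Symbol.nonterminal c] = terminals e u ++ m.map Symbol.nonterminal) :
    ∃ m', m = m' ++ [c] := by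
  obtain ⟨m₁, m₂, rfl, -, h2⟩ := exists_eq_of_append_nonterminal_eq_form (e := e) (v := [])
    (by simpa [form] using h)
  obtain rfl : m₂ = [] := by simpa using h2.symm
  exact ⟨m₁, rfl⟩

theorem eq_nil_of_append_terminal_eq {e : ι → T} {p : List (Symbol T (CopyNT ι))}
    {c : T} {u : List ι} {m : List (CopyNT ι)}
    (h : p ++ [Symbol.terminal c] = terminals e u ++ m.map Symbol.nonterminal) : m = [] := by
  rcases List.eq_nil_or_concat m with rfl | ⟨m, x, rfl⟩
  · rfl
  · rw [List.concat_eq_append, List.map_append, ← List.append_assoc] at h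
    have := List.append_inj_right' h rfl
    simp at this

/-- Every sentential form is the initial symbol or balanced. -/
def Invariant (e : ι → T) (s : List (Symbol T (CopyNT ι))) : Prop :=
  s = [Symbol.nonterminal start] ∨ ∃ u m v, s = form e u m v ∧ Balanced u m v

/-- Handles the four swap rules. The tracks are compared with `m₂` attached because its first letter
may depend on the last symbol of the replaced infix. -/
theorem Balanced.of_infix {u v : List ι} {m₁ m₂ l l' : List (CopyNT ι)}
    (h : Balanced u (m₁ ++ l ++ m₂) v) (hl : l ≠ []) (hgen : gen ∉ l) (hstart' : start ∉ l')
    (hgen' : gen ∉ l')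
    (hfst : ∀ prev, track fstLetter prev (l ++ m₂) = track fstLetter prev (l' ++ m₂))
    (hsnd : ∀ prev, track sndLetter prev (l ++ m₂) = track sndLetter prev (l' ++ m₂)) :
    Balanced u (m₁ ++ l' ++ m₂) v := by
  obtain ⟨h1, h2, h3⟩ := h
  refine ⟨?_, ?_, ?_⟩
  · simp only [List.mem_append, not_or] at h1 ⊢
    exact ⟨⟨h1.1.1, hstart'⟩, h1.2⟩
  · rcases h2 with h2 | ⟨hu, k, hk, hk'⟩
    · simp only [List.mem_append, not_or] at h2 ⊢
      exact Or.inl ⟨⟨h2.1.1, hgen'⟩, h2.2⟩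
    · right
      refine ⟨hu, ?_⟩
      cases m₁ with
      | nil =>
        cases l with
        | nil => exact (hl rfl).elim
        | cons x l =>
          simp only [List.nil_append, List.cons_append, List.cons.injEq] at hk
          exact (hgen (by simp [hk.1])).elim
      | cons x m₁ =>
        simp only [List.cons_append, List.cons.injEq] at hk
        obtain ⟨rfl, rfl⟩ := hk
        refine ⟨m₁ ++ l' ++ m₂, rfl, ?_⟩
        simp only [List.mem_append, not_or] at hk' ⊢
        exact ⟨⟨hk'.1.1, hgen'⟩, hk'.2⟩
  · rw [List.append_assoc, track_append _ _ m₁, track_append _ _ m₁] at h3 ⊢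
    rwa [← hfst, ← hsnd]

theorem Balanced.gen_eq {u v : List ι} {m₁ m₂ : List (CopyNT ι)}
    (h : Balanced u (m₁ ++ gen :: m₂) v) : u = [] ∧ m₁ = [] ∧ gen ∉ m₂ := by
  rcases h.gen_notMem with h | ⟨hu, l, hl, hl'⟩
  · simp at h
  · cases m₁ with
    | nil =>
      obtain rfl := (List.cons.inj hl).2
      exact ⟨hu, rfl, hl'⟩
    | cons x m₁ =>
      obtain rfl := (List.cons.inj hl).2
      simp at hl'

theorem Invariant.rewrites {e : ι → T} {r : ContextSensitiveRule T (CopyNT ι)} (hr : IsRule e r)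
    {s t : List (Symbol T (CopyNT ι))} (hs : Invariant e s) (h : r.Rewrites s t) :
    Invariant e t := by
  obtain ⟨p, q, hsr, rfl⟩ := h
  rcases hs with rfl | ⟨u, m, v, rfl, hb⟩
  · obtain ⟨m₁, m₂, hm, hp, hq⟩ := exists_eq_of_append_nonterminal_eq_form (e := e) (u := [])
      (v := []) (m := [start]) (p := p ++ r.left) (q := r.right ++ q) (c := r.core)
      (by simpa [form] using hsr.symm)
    obtain ⟨rfl, hc, rfl⟩ : m₁ = [] ∧ r.core = start ∧ m₂ = [] := by
      cases m₁ <;> simp at hm ⊢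
      exact ⟨hm.1.symm, hm.2⟩
    simp only [List.map_nil, List.append_nil, List.append_eq_nil_iff] at hp hq
    obtain ⟨rfl, -⟩ := hp
    obtain ⟨-, rfl⟩ := hq
    cases hr <;> simp only [reduceCtorEq] at hc
    case start_nil => exact Or.inr ⟨[], [], [], rfl, by simp, by simp, rfl⟩
    case start_pair a => exact Or.inr ⟨[a], [], [a], rfl, by simp, by simp, rfl⟩
    case start_gen a =>
      exact Or.inr ⟨[], [gen, fst a], [a], rfl, by simp, Or.inr ⟨rfl, _, rfl, by simp⟩, rfl⟩
  · obtain ⟨m₁, m₂, rfl, hp, hq⟩ := exists_eq_of_append_nonterminal_eq_form (e := e)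
      (p := p ++ r.left) (q := r.right ++ q) (c := r.core) (by simpa using hsr.symm)
    have ht : p ++ r.left ++ r.output ++ r.right ++ q = (terminals e u ++
        m₁.map Symbol.nonterminal) ++ r.output ++ (m₂.map Symbol.nonterminal ++ terminals e v) := by
      rw [← hp, ← hq]
      simp
    rw [ht]
    clear ht hsr
    cases hr
    case start_nil => exact (hb.start_notMem (by simp)).elim
    case start_pair => exact (hb.start_notMem (by simp)).elim
    case start_gen => exact (hb.start_notMem (by simp)).elim
    case gen_pair a =>
      -- While `gen` is present it heads the form, so the new letter is prepended to both tracks and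
      -- the balance is kept.
      obtain ⟨rfl, rfl, hg⟩ := hb.gen_eq
      refine Or.inr ⟨[], gen :: fst a :: snd a :: m₂, v, by simp [form], ?_, ?_, ?_⟩
      · simpa using hb.start_notMem
      · exact Or.inr ⟨rfl, _, rfl, by simpa using hg⟩
      · have := hb.eq
        simp only [List.nil_append, track, fstLetter, sndLetter] at this ⊢
        rw [track_fstLetter_congr (q := some gen) (by simp [NotHeld]) (by simp [NotHeld]),
          track_sndLetter_congr (q := some gen) (by simp [NotHeld]) (by simp [NotHeld])]
        simpa using this
    case gen_last a =>
      obtain ⟨rfl, rfl, hg⟩ := hb.gen_eq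
      refine Or.inr ⟨[a], snd a :: m₂, v, by simp [form], ?_, ?_, ?_⟩
      · simpa using hb.start_notMem
      · exact Or.inl (by simpa using hg)
      · have := hb.eq
        simp only [List.nil_append, track, fstLetter, sndLetter] at this ⊢
        rw [track_fstLetter_congr (q := some gen) (by simp [NotHeld]) (by simp [NotHeld]),
          track_sndLetter_congr (q := some gen) (by simp [NotHeld]) (by simp [NotHeld])]
        simpa using this
    case hold a b =>
      obtain ⟨m₂, rfl⟩ := exists_eq_of_nonterminal_cons_eq hq
      refine Or.inr ⟨u, m₁ ++ [held a b, fst b] ++ m₂, v, by simp [form], ?_⟩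
      refine Balanced.of_infix (l := [snd a, fst b]) (by simpa using hb) (by simp) (by simp)
        (by simp) (by simp) ?_ ?_ <;> intro prev <;> simp [track, fstLetter, sndLetter]
    case swap a b =>
      obtain ⟨m₁, rfl⟩ := exists_eq_of_append_nonterminal_eq hp
      refine Or.inr ⟨u, m₁ ++ [held a b, swapped a b] ++ m₂, v, by simp [form], ?_⟩
      refine Balanced.of_infix (l := [held a b, fst b]) (by simpa using hb) (by simp) (by simp)
        (by simp) (by simp) ?_ ?_ <;> intro prev <;> simp [track, fstLetter, sndLetter]
      · exact track_fstLetter_congr (by simp [NotHeld]) (by simp [NotHeld]) _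
      · exact track_sndLetter_congr (by simp [NotHeld]) (by simp [NotHeld]) _
    case release a b =>
      obtain ⟨m₂, rfl⟩ := exists_eq_of_nonterminal_cons_eq hq
      refine Or.inr ⟨u, m₁ ++ [fst b, swapped a b] ++ m₂, v, by simp [form], ?_⟩
      refine Balanced.of_infix (l := [held a b, swapped a b]) (by simpa using hb) (by simp)
        (by simp) (by simp) (by simp) ?_ ?_ <;> intro prev <;> simp [track, fstLetter, sndLetter]
    case finish a b =>
      obtain ⟨m₁, rfl⟩ := exists_eq_of_append_nonterminal_eq hp
      refine Or.inr ⟨u, m₁ ++ [fst b, snd a] ++ m₂, v, by simp [form], ?_⟩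
      refine Balanced.of_infix (l := [fst b, swapped a b]) (by simpa using hb) (by simp) (by simp)
        (by simp) (by simp) ?_ ?_ <;> intro prev <;> simp [track, fstLetter, sndLetter]
      · exact track_fstLetter_congr (by simp [NotHeld]) (by simp [NotHeld]) _
      · exact track_sndLetter_congr (by simp [NotHeld]) (by simp [NotHeld]) _
    case fst_terminal c b =>
      obtain rfl := eq_nil_of_append_terminal_eq hp
      refine Or.inr ⟨u ++ [b], m₂, v, by simp [form], ?_, ?_, ?_⟩
      · have := hb.start_notMem
        simp_all
      · have := hb.gen_notMem
        simp_all
      · have := hb.eq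
        simp only [List.nil_append, track, fstLetter, sndLetter] at this
        rw [track_fstLetter_congr (q := some (fst b)) (by simp [NotHeld]) (by simp [NotHeld]),
          track_sndLetter_congr (q := some (fst b)) (by simp [NotHeld]) (by simp [NotHeld])]
        simpa using this
    case snd_terminal c b =>
      obtain rfl := eq_nil_of_terminal_cons_eq hq
      refine Or.inr ⟨u, m₁, b :: v, by simp [form], ?_, ?_, ?_⟩
      · have := hb.start_notMem
        simp_all
      · rcases hb.gen_notMem with h | ⟨hu, l, hl, hl'⟩
        · exact Or.inl (by simp_all)
        · right
          refine ⟨hu, ?_⟩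
          cases m₁ with
          | nil => simp at hl
          | cons x m₁ =>
            obtain ⟨rfl, rfl⟩ := List.cons.inj hl
            exact ⟨m₁, rfl, by simp_all⟩
      · have := hb.eq
        simpa [track_append, track, fstLetter, sndLetter] using this

theorem invariant_of_derives [Finite ι] {e : ι → T} {s : List (Symbol T (CopyNT ι))}
    (h : Derives e [Symbol.nonterminal start] s) : Invariant e s := by
  induction h with
  | refl => exact Or.inl rfl
  | tail _ h ih =>
    obtain ⟨r, hr, h⟩ := h
    exact ih.rewrites ((finite_isRule e).mem_toFinset.1 hr) h

end Invariant

theorem language_grammar [Finite ι] {e : ι → T} (he : Function.Surjective e) :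
    (grammar e).language = copyLanguage T := by
  have hiff : ∀ w : List T, w ∈ (grammar e).language ↔
      Derives e [Symbol.nonterminal start] (w.map Symbol.terminal) := fun _ => Iff.rfl
  ext w
  rw [hiff]
  constructor
  · intro h
    have hnot : ∀ x : CopyNT ι, Symbol.nonterminal x ∉ w.map Symbol.terminal := by simp
    rcases invariant_of_derives h with h | ⟨u, m, v, h, hb⟩
    · exact (hnot start (by simp [h])).elim
    -- A terminal word has no middle block, and the balance reduces to `u = v`.
    · obtain rfl : m = [] :=
        List.eq_nil_iff_forall_not_mem.2 fun x hx => hnot x (by simp [h, form, hx])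
      obtain rfl : u = v := by simpa [track] using hb.eq
      refine ⟨u.map e, List.map_injective_iff.2 (fun _ _ => Symbol.terminal.inj) (h.trans ?_)⟩
      simp [form, Function.comp_def]
  · rintro ⟨v, rfl⟩
    obtain ⟨l, rfl⟩ := List.map_surjective_iff.2 he v
    simpa [Function.comp_def] using derives_copy e l

end CopyNT

theorem isContextSensitive_copyLanguage (α : Type u) [Finite α] :
    IsContextSensitive (copyLanguage α) := by
  obtain ⟨n, ⟨e⟩⟩ := Finite.exists_equiv_fin α
  exact ⟨CopyNT.grammar e.symm, CopyNT.language_grammar e.symm.surjective⟩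

theorem mainTheorem3 (α : Type*) [Finite α] [Nontrivial α] :
    (IsContextSensitive (copyLanguage α) ∧ ¬ (copyLanguage α).IsContextFree) ∧
    ¬ CRASP.Definable (copyLanguage α) ∧
    ∃ c : ℝ, 0 < c ∧ ∀ (n B : ℕ) (P : OneWayProtocol α),
      P.Recognizes (copyLanguage α) n n → P.CostAtMost n B → c * ((2 * n : ℕ) : ℝ) ≤ (B : ℝ) := by
  -- The communication bound `n ≤ B` is half of the input length `2 * n`, hence the constant `1 /
  -- 2`.
  refine ⟨⟨isContextSensitive_copyLanguage α, not_isContextFree_copyLanguage α⟩,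
    CRASP.not_definable_copyLanguage, 1 / 2, by norm_num, fun n B P hP hB => ?_⟩
  have h : (n : ℝ) ≤ B := by
    exact_mod_cast OneWayProtocol.le_cost_of_recognizes_copyLanguage hP hB
  push_cast
  linarith
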